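/- Let $[\beta_{n,k}]_{n\ge 1,\,k\ge 0}$ be the array of integers associated with the Lambert $W$ function (the solution of $We^W=x$), that is, the array in $$\frac{d^nW(x)}{dx^n}=\frac{e^{-nW(x)}\,p_n(W(x))}{(1+W(x))^{2n-1}},\qquad p_n(x)=(-1)^{n-1}\sum_{k=0}^{n-1}\beta_{n,k}x^k\qquad(n\ge 1).$$ It is determined by $\beta_{1,0}=1$, $\beta_{1,k}=0$ for $k\ge 1$, and $$\beta_{n+1,k}=(3n-k-1)\beta_{n,k}+n\,\beta_{n,k-1}-(k+1)\beta_{n,k+1}\qquad (n\ge 1,\ k\ge 0),$$ where $\beta_{n,-1}=0$; in particular $\beta_{n,k}=0$ for $k\ge n$. Let $\beta_n(q)=\sum_{k=0}^{n-1}\beta_{n,k}q^k$ for $n\ge 1$. Then: (i) every row is positive: $\beta_{n,k}>0$ for all $n\ge 1$ and $0\le k\le n-1$; (ii) every row is log-concave: $\beta_{n,k}\,\beta_{n,k+2}\le \beta_{n,k+1}^2$ for all $n\ge 1$ and $k\ge 0$; (iii) the row polynomials $\beta_1(q),\beta_2(q),\beta_3(q),\dots$ form a strongly $q$-log-convex sequence: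 with $f_n(q)=\beta_{n+1}(q)$ for $n\ge 0$, the polynomial $$f_{n+1}(q)f_{m-1}(q)-f_n(q)f_m(q)$$ has only nonnegative coefficients for all $n\ge m\ge 1$. -/

import Mathlib

open Polynomial

/-- The array `β_{n,k}` from the Lambert `W` function: its rows are indexed by `n ≥ 1`, with
`β_{1,0} = 1`, `β_{1,k} = 0` for `k ≥ 1`, and
`β_{n+1,k} = (3n-k-1) β_{n,k} + n β_{n,k-1} - (k+1) β_{n,k+1}` for `n ≥ 1`, `k ≥ 0`, where
`β_{n,-1} = 0`. The array has no row `n = 0`; that row is filled with the dummy value `0`. -/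
def lambertArray : ℕ → ℕ → ℤ
  | 0, _ => 0
  | 1, 0 => 1
  | 1, _ + 1 => 0
  | n + 2, 0 => (3 * ((n : ℤ) + 1) - 1) * lambertArray (n + 1) 0 - lambertArray (n + 1) 1
  | n + 2, k + 1 =>
      (3 * ((n : ℤ) + 1) - ((k : ℤ) + 1) - 1) * lambertArray (n + 1) (k + 1)
        + ((n : ℤ) + 1) * lambertArray (n + 1) k
        - (((k : ℤ) + 1) + 1) * lambertArray (n + 1) (k + 2)

/-- The row polynomial `β_n(q) = ∑_{k=0}^{n-1} β_{n,k} q^k`. -/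
noncomputable def lambertPoly (n : ℕ) : ℤ[X] :=
  ∑ k ∈ Finset.range n, C (lambertArray n k) * X ^ k

/-- A sequence is log-concave if `a_k a_{k+2} ≤ a_{k+1}^2` for all `k ≥ 0`. -/
def IsLogConcaveSeq (a : ℕ → ℤ) : Prop :=
  ∀ k : ℕ, a k * a (k + 2) ≤ a (k + 1) ^ 2

/-- A sequence of polynomials `f_0, f_1, …` is strongly `q`-log-convex if all coefficients of
`f_{n+1} f_{m-1} - f_n f_m` are nonnegative whenever `n ≥ m ≥ 1`. -/
def StronglyQLogConvex (f : ℕ → ℤ[X]) : Prop :=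
  ∀ n m : ℕ, 1 ≤ m → m ≤ n →
    ∀ i : ℕ, 0 ≤ (f (n + 1) * f (m - 1) - f n * f m).coeff i

/-- The entries of row `n` vanish outside `0 ≤ k ≤ n - 1`. -/
theorem lambertArray_eq_zero (n k : ℕ) (h : n ≤ k) : lambertArray n k = 0 := by
  induction n generalizing k with
  | zero => simp [lambertArray]
  | succ n ih =>
    cases n with
    | zero =>
      obtain ⟨j, rfl⟩ : ∃ j, k = j + 1 := ⟨k - 1, by omega⟩
      simp [lambertArray]
    | succ n =>
      obtain ⟨j, rfl⟩ : ∃ j, k = j + 1 := ⟨k - 1, by omega⟩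
      simp [lambertArray, ih (j + 1) (by omega), ih j (by omega), ih (j + 2) (by omega)]

theorem lambertPoly_coeff (n k : ℕ) : (lambertPoly n).coeff k = lambertArray n k := by
  simp only [lambertPoly, finsetSum_coeff, coeff_C_mul, coeff_X_pow]
  by_cases h : k < n
  · simp [h]
  · simp [h, lambertArray_eq_zero n k (by omega)]

/-- `β_{n+1} = (nX + 3n - 1) β_n - (1 + X) β_n'` for `n ≥ 1`, that is, the polynomials
`p_n = (-1)^{n-1} β_n` satisfy `p_{n+1} = -(nX + 3n - 1) p_n + (1 + X) p_n'`. -/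
theorem lambertPoly_succ (n : ℕ) :
    lambertPoly (n + 2) =
      (C ((n : ℤ) + 1) * X + C (3 * ((n : ℤ) + 1) - 1)) * lambertPoly (n + 1)
        - (1 + X) * derivative (lambertPoly (n + 1)) := by
  ext k
  cases k with
  | zero =>
    simp only [coeff_sub, add_mul, one_mul, coeff_add, mul_assoc, coeff_C_mul,
      coeff_X_mul_zero, coeff_derivative, lambertPoly_coeff, lambertArray]
    push_cast
    ring
  | succ k =>
    simp only [coeff_sub, add_mul, one_mul, coeff_add, mul_assoc, coeff_C_mul,
      coeff_X_mul, coeff_derivative, lambertPoly_coeff, lambertArray]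
    push_cast
    ring

/-- The array comes from the Lambert function: on every open set on which a differentiable
function `W` solves `W e^W = x`, one has `1 + W ≠ 0` and, for `n ≥ 1` (written `n + 1` here),
`W^{(n)} = e^{-nW} p_n(W) / (1 + W)^{2n-1}` with `p_n = (-1)^{n-1} β_n`. -/
theorem lambert_iteratedDeriv {W : ℝ → ℝ} {U : Set ℝ} (hU : IsOpen U)
    (hd : DifferentiableOn ℝ W U) (hW : ∀ x ∈ U, W x * Real.exp (W x) = x) (n : ℕ) :
    ∀ x ∈ U, 1 + W x ≠ 0 ∧
      iteratedDeriv (n + 1) W x =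
        Real.exp (-(((n : ℝ) + 1) * W x)) * ((-1) ^ n * aeval (W x) (lambertPoly (n + 1)))
          / (1 + W x) ^ (2 * n + 1) := by
  have key : ∀ x ∈ U, deriv W x * ((1 + W x) * Real.exp (W x)) = 1 := by
    intro x hx
    have h1 : HasDerivAt W (deriv W x) x :=
      ((hd x hx).differentiableAt (hU.mem_nhds hx)).hasDerivAt
    have h2 := h1.mul h1.exp
    have h3 : HasDerivAt (fun y => y) (1 : ℝ) x := hasDerivAt_id x
    have h4 : (fun y => y) =ᶠ[nhds x] (W * fun y => Real.exp (W y)) := by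
      filter_upwards [hU.mem_nhds hx] with y hy
      exact (hW y hy).symm
    have h5 := (h2.congr_of_eventuallyEq h4).unique h3
    linear_combination h5
  have hne : ∀ x ∈ U, 1 + W x ≠ 0 := by
    intro x hx h0
    have := key x hx
    rw [h0] at this
    simp at this
  have hder : ∀ x ∈ U, deriv W x = Real.exp (-W x) / (1 + W x) := by
    intro x hx
    have h := hne x hx
    rw [Real.exp_neg, eq_div_iff h, ← mul_eq_one_iff_eq_inv₀ (Real.exp_ne_zero _)]
    linear_combination key x hx
  induction n with
  | zero =>
    intro x hx
    refine ⟨hne x hx, ?_⟩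
    simp [iteratedDeriv_one, hder x hx, lambertPoly, lambertArray]
  | succ n ih =>
    intro x hx
    refine ⟨hne x hx, ?_⟩
    have h := hne x hx
    rw [iteratedDeriv_succ]
    have hev : iteratedDeriv (n + 1) W =ᶠ[nhds x] fun x =>
        Real.exp (-(((n : ℝ) + 1) * W x)) * ((-1) ^ n * aeval (W x) (lambertPoly (n + 1)))
          / (1 + W x) ^ (2 * n + 1) := by
      filter_upwards [hU.mem_nhds hx] with y hy
      exact (ih y hy).2
    rw [hev.deriv_eq]
    have h1 : HasDerivAt W (Real.exp (-W x) / (1 + W x)) x := by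
      rw [← hder x hx]
      exact ((hd x hx).differentiableAt (hU.mem_nhds hx)).hasDerivAt
    have hp : HasDerivAt (fun y => aeval (W y) (lambertPoly (n + 1)))
        (aeval (W x) (derivative (lambertPoly (n + 1))) * (Real.exp (-W x) / (1 + W x))) x :=
      ((lambertPoly (n + 1)).hasDerivAt_aeval (W x)).comp x h1
    have he := (h1.const_mul ((n : ℝ) + 1)).neg.exp
    have hq := (h1.const_add 1).pow (2 * n + 1)
    have hall := (he.mul (hp.const_mul ((-1 : ℝ) ^ n))).div hq (pow_ne_zero _ h)
    refine hall.deriv.trans ?_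
    have hexp : Real.exp (-((((n + 1 : ℕ) : ℝ) + 1) * W x))
        = Real.exp (-(((n : ℝ) + 1) * W x)) * Real.exp (-W x) := by
      rw [← Real.exp_add]
      congr 1
      push_cast
      ring
    rw [hexp, lambertPoly_succ]
    simp only [map_sub, map_add, map_mul, aeval_X, map_one, aeval_C, Pi.mul_apply, Pi.pow_apply,
      Pi.neg_apply]
    simp
    field_simp
    ring

/-! Everything rests on `lambertPoly_eq_taylor`: `β_{n+1}(q) = (1+q)^n r_n(1/(1+q))` with `r_n` the
Ramanujan polynomials, whose recurrence has no negative terms. Their rows are positive and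
log-concave, and their triangle is totally positive of order two (`ramanujanArray_minor`). Reversal
preserves log-concavity, and so does `X ↦ X + 1` (`IsPosLogConcave.taylor_one`); this gives (ii).
Positivity follows because a zero would propagate to the last entry of its row. For (iii), `r_{n+1}
r_p - r_n r_{p+1}` is `(n-p)(1+X) r_n r_p` plus `X²` times a Wronskian, nonnegative by total
positivity; reversal and shift keep the signs. -/

/-! ### Log-concave sequences without internal zeros. -/

/-- A sequence of nonnegative integers that is log-concave and, once zero, stays zero. -/
structure IsPosLogConcave (a : ℕ → ℤ) : Prop where
  nonneg : ∀ k, 0 ≤ a k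
  logConcave : IsLogConcaveSeq a
  zero_succ : ∀ k, a k = 0 → a (k + 1) = 0

/-- Transitivity of `a/b ≤ c/d ≤ e/f`, cross-multiplied so that `b` and `f` may vanish. -/
theorem mul_le_mul_of_ratio_trans {a b c d e f : ℤ} (hb : 0 ≤ b) (hd : 0 < d) (hf : 0 ≤ f)
    (h₁ : a * d ≤ c * b) (h₂ : c * f ≤ e * d) : a * f ≤ e * b := by
  refine le_of_mul_le_mul_right ?_ hd
  nlinarith [mul_le_mul_of_nonneg_right h₁ hf, mul_le_mul_of_nonneg_right h₂ hb]

namespace IsPosLogConcave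

theorem zero_of_le {a : ℕ → ℤ} (h : IsPosLogConcave a) {i j : ℕ} (hij : i ≤ j) (hi : a i = 0) :
    a j = 0 := by
  induction j, hij using Nat.le_induction with
  | base => exact hi
  | succ j _ ih => exact h.zero_succ j ih

theorem tail {a : ℕ → ℤ} (h : IsPosLogConcave a) : IsPosLogConcave fun k => a (k + 1) :=
  ⟨fun _ => h.nonneg _, fun k => h.logConcave (k + 1), fun _ hk => h.zero_succ _ hk⟩

theorem mul_le_mul_inner {a : ℕ → ℤ} (h : IsPosLogConcave a) (k : ℕ) :
    a k * a (k + 3) ≤ a (k + 1) * a (k + 2) := by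
  rcases (h.nonneg (k + 2)).eq_or_lt with h0 | hpos
  · rw [h.zero_succ (k + 2) h0.symm, ← h0]; simp
  · have h1 := h.logConcave k
    have h2 := h.logConcave (k + 1)
    have := mul_le_mul_of_ratio_trans (a := a k) (b := a (k + 1)) (c := a (k + 1)) (d := a (k + 2))
      (e := a (k + 2)) (f := a (k + 3)) (h.nonneg _) hpos (h.nonneg _)
      (by linarith [sq (a (k + 1))]) (by linarith [sq (a (k + 2))])
    linarith

/-- The coefficient sequence of a product with `1 + X`, without its constant term. -/
theorem add_succ {s : ℕ → ℤ} (h : IsPosLogConcave s) :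
    IsPosLogConcave fun k => s k + s (k + 1) := by
  refine ⟨fun k => add_nonneg (h.nonneg _) (h.nonneg _), fun k => ?_, fun k hk => ?_⟩
  · have h1 := h.logConcave k
    have h2 : s (k + 1) * s (k + 3) ≤ s (k + 2) ^ 2 := h.logConcave (k + 1)
    have h3 := h.mul_le_mul_inner k
    change (s k + s (k + 1)) * (s (k + 2) + s (k + 3)) ≤ (s (k + 1) + s (k + 2)) ^ 2
    -- The sum of the three inequalities, after adding `s (k+1) * s (k+2)` to both sides.
    nlinarith
  · have h0 := h.nonneg k
    have h1 := h.nonneg (k + 1)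
    have h2 : s (k + 1) = 0 := by linarith
    have h3 := h.zero_succ _ h2
    simp [h2, h3]

theorem cons {x : ℤ} {c : ℕ → ℤ} (hc : IsPosLogConcave c) (hx : 0 ≤ x)
    (h : x * c 1 ≤ c 0 ^ 2) (h0 : x = 0 → c 0 = 0) :
    IsPosLogConcave fun k => Nat.casesOn k x c := by
  refine ⟨fun k => ?_, fun k => ?_, fun k hk => ?_⟩ <;> cases k
  · exact hx
  · exact hc.nonneg _
  · exact h
  · exact hc.logConcave _
  · exact h0 hk
  · exact hc.zero_succ _ hk

end IsPosLogConcave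

/-! ### The shift `X ↦ X + 1`. -/

theorem taylor_one_eq_divX (f : ℤ[X]) :
    taylor 1 f = taylor 1 f.divX * (X + 1) + C (f.coeff 0) := by
  conv_lhs => rw [← divX_mul_X_add f]
  rw [map_add, taylor_mul, taylor_X, taylor_C, C_1]

theorem taylor_one_coeff_zero (f : ℤ[X]) :
    (taylor 1 f).coeff 0 = f.coeff 0 + (taylor 1 f.divX).coeff 0 := by
  rw [taylor_one_eq_divX]
  simp [mul_add, add_comm, -taylor_coeff_zero]

theorem taylor_one_coeff_succ (f : ℤ[X]) (k : ℕ) :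
    (taylor 1 f).coeff (k + 1) =
      (taylor 1 f.divX).coeff k + (taylor 1 f.divX).coeff (k + 1) := by
  rw [taylor_one_eq_divX]
  rw [coeff_add, mul_add, mul_one, coeff_add, coeff_mul_X, coeff_C_succ, add_zero]

theorem IsPosLogConcave.eq_zero_of_coeff_zero {f : ℤ[X]} (hf : IsPosLogConcave f.coeff)
    (h : f.coeff 0 = 0) : f = 0 := by
  ext k
  exact hf.zero_of_le (Nat.zero_le k) h

/-- The substitution `X ↦ X + 1` preserves log-concavity, together with the two inequalities that
carry the induction on the degree. -/
theorem IsPosLogConcave.taylor_one_aux (N : ℕ) :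
    ∀ f : ℤ[X], (∀ k, N ≤ k → f.coeff k = 0) → IsPosLogConcave f.coeff →
      IsPosLogConcave (taylor 1 f).coeff ∧
      f.coeff 0 * (taylor 1 f.divX).coeff 1 ≤ (taylor 1 f.divX).coeff 0 ^ 2 ∧
      f.coeff 0 * (taylor 1 f.divX.divX).coeff 0 ≤
        f.coeff 1 * (taylor 1 f.divX).coeff 0 := by
  induction N with
  | zero =>
    intro f hN hf
    obtain rfl : f = 0 := by ext k; exact hN k (Nat.zero_le k)
    simpa using hf
  | succ N ih =>
    intro f hN hf
    have hgc : ∀ k, f.divX.coeff k = f.coeff (k + 1) := fun k => coeff_divX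
    have hg : IsPosLogConcave f.divX.coeff := by
      have := hf.tail
      simpa only [← hgc] using this
    have hgg : IsPosLogConcave f.divX.divX.coeff := by
      have := hg.tail
      simpa only [← coeff_divX] using this
    obtain ⟨hc, hE, hR⟩ := ih f.divX (fun k hk => by rw [hgc]; exact hN _ (by omega)) hg
    obtain ⟨hd, -, -⟩ := ih f.divX.divX
      (fun k hk => by rw [coeff_divX, hgc]; exact hN _ (by omega)) hgg
    have hc0 := taylor_one_coeff_zero f.divX
    have hc1 := taylor_one_coeff_succ f.divX 0
    have hd0 := taylor_one_coeff_zero f.divX.divX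
    rw [coeff_divX, zero_add] at hd0
    simp only [zero_add] at hc1
    have hlc := hf.logConcave 0
    simp only [zero_add, coeff_divX, Nat.reduceAdd] at hE hR hc0 hlc hd0
    set c := (taylor 1 f.divX).coeff with hcdef
    set d := (taylor 1 f.divX.divX).coeff with hddef
    set e := (taylor 1 f.divX.divX.divX).coeff with hedef
    -- As `c 0 = f₁ + d 0` and `d 0 = f₂ + e 0`, it suffices that `f₀ f₂ ≤ f₁²` and `f₀ e 0 ≤ f₁ d
    -- 0`; the latter, times `f₁`, follows from `hR` and the former.
    have hR' : f.coeff 0 * d 0 ≤ f.coeff 1 * c 0 := by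
      rcases (hf.nonneg 1).eq_or_lt with h0 | hpos
      · have hgz : f.divX = 0 := hg.eq_zero_of_coeff_zero (by rw [hgc]; exact h0.symm)
        rw [hddef, hcdef, hgz]
        simp
      · refine le_of_mul_le_mul_right ?_ hpos
        have h1 := mul_le_mul_of_nonneg_left hR (hf.nonneg 0)
        have h2 := mul_le_mul_of_nonneg_right hlc (hd.nonneg 0)
        have h3 := mul_le_mul_of_nonneg_right hlc hpos.le
        have h4 : f.coeff 0 * d 0 * f.coeff 1 =
            f.coeff 0 * f.coeff 2 * f.coeff 1 + f.coeff 0 * (f.coeff 1 * e 0) := by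
          rw [hd0]; ring
        rw [hc0]
        linarith
    have hE' : f.coeff 0 * c 1 ≤ c 0 ^ 2 := by
      -- The ratio chain `f₀/c 0 ≤ f₁/d 0 ≤ d 0/d 1`, by `hR'` and `hE`.
      have key : f.coeff 0 * d 1 ≤ d 0 * c 0 := by
        rcases (hd.nonneg 0).eq_or_lt with h0 | hpos
        · rw [hd.zero_succ 0 h0.symm, ← h0]; simp
        · exact mul_le_mul_of_ratio_trans (hc.nonneg 0) hpos (hd.nonneg 1) hR'
            (by linarith [sq (d 0)])
      have h : c 0 ^ 2 = f.coeff 1 * c 0 + d 0 * c 0 := by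
        rw [sq, ← add_mul, ← hc0]
      rw [hc1, h, mul_add]
      exact add_le_add hR' key
    refine ⟨?_, hE', hR'⟩
    -- The coefficients of `f(X+1)` are the sums of neighbours in `f₀, c 0, c 1, …`.
    have hs := hc.cons (hf.nonneg 0) hE' (fun h0 => by
      rw [hcdef, hf.eq_zero_of_coeff_zero h0]; simp)
    have hb := hs.add_succ
    convert hb using 2 with k
    cases k with
    | zero => exact taylor_one_coeff_zero f
    | succ k => exact taylor_one_coeff_succ f k

theorem IsPosLogConcave.taylor_one {f : ℤ[X]} (hf : IsPosLogConcave f.coeff) :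
    IsPosLogConcave (taylor 1 f).coeff :=
  (taylor_one_aux (f.natDegree + 1) f
    (fun _ hk => coeff_eq_zero_of_natDegree_lt hk) hf).1

theorem taylor_one_coeff_nonneg {f : ℤ[X]} (hf : ∀ k, 0 ≤ f.coeff k) (k : ℕ) :
    0 ≤ (taylor 1 f).coeff k := by
  rw [taylor_coeff, eval_eq_sum_range]
  refine Finset.sum_nonneg fun i _ => ?_
  rw [hasseDeriv_coeff, one_pow, mul_one]
  exact mul_nonneg (by positivity) (hf _)

/-! ### Nonnegative coefficients of products and Wronskians. -/

theorem coeff_mul_nonneg {f g : ℤ[X]} (hf : ∀ k, 0 ≤ f.coeff k) (hg : ∀ k, 0 ≤ g.coeff k)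
    (k : ℕ) : 0 ≤ (f * g).coeff k := by
  rw [coeff_mul]
  exact Finset.sum_nonneg fun _ _ => mul_nonneg (hf _) (hg _)

theorem coeff_X_mul_derivative (f : ℤ[X]) (k : ℕ) :
    (X * derivative f).coeff k = k * f.coeff k := by
  cases k with
  | zero => simp
  | succ k => rw [coeff_X_mul, coeff_derivative]; push_cast; ring

/-- The Wronskian of two polynomials whose coefficient ratio is monotone. -/
theorem coeff_X_mul_wronskian_nonneg {f g : ℤ[X]}
    (h : ∀ i j, j ≤ i → g.coeff i * f.coeff j ≤ f.coeff i * g.coeff j) (s : ℕ) :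
    0 ≤ (X * (derivative f * g - f * derivative g)).coeff s := by
  have h1 : (X * (derivative f * g - f * derivative g)).coeff s =
      ∑ p ∈ Finset.HasAntidiagonal.antidiagonal s, ((p.1 : ℤ) - p.2) * (f.coeff p.1 * g.coeff p.2) := by
    have : X * (derivative f * g - f * derivative g) =
        (X * derivative f) * g - f * (X * derivative g) := by ring
    rw [this, coeff_sub, coeff_mul, coeff_mul, ← Finset.sum_sub_distrib]
    refine Finset.sum_congr rfl fun p _ => ?_
    rw [coeff_X_mul_derivative, coeff_X_mul_derivative]
    ring
  have h2 : ∑ p ∈ Finset.HasAntidiagonal.antidiagonal s, ((p.1 : ℤ) - p.2) * (f.coeff p.1 * g.coeff p.2) =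
      ∑ p ∈ Finset.HasAntidiagonal.antidiagonal s, ((p.2 : ℤ) - p.1) * (f.coeff p.2 * g.coeff p.1) :=
    (Finset.Nat.sum_antidiagonal_swap (n := s)
      (f := fun p : ℕ × ℕ => ((p.1 : ℤ) - p.2) * (f.coeff p.1 * g.coeff p.2))).symm
  -- Swapped pairs combine to `(i - j)(f_i g_j - f_j g_i)`, whose factors have the same sign.
  have h3 : 0 ≤ ∑ p ∈ Finset.HasAntidiagonal.antidiagonal s, (((p.1 : ℤ) - p.2) * (f.coeff p.1 * g.coeff p.2) +
      ((p.2 : ℤ) - p.1) * (f.coeff p.2 * g.coeff p.1)) := by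
    refine Finset.sum_nonneg fun p _ => ?_
    rcases le_total p.2 p.1 with hp | hp
    · have hp' : (0 : ℤ) ≤ (p.1 : ℤ) - p.2 := by omega
      nlinarith [mul_nonneg hp' (sub_nonneg.2 (h _ _ hp))]
    · have hp' : (0 : ℤ) ≤ (p.2 : ℤ) - p.1 := by omega
      nlinarith [mul_nonneg hp' (sub_nonneg.2 (h _ _ hp))]
  rw [Finset.sum_add_distrib, ← h2] at h3
  rw [h1]
  linarith

/-! ### The Ramanujan triangle. -/

/-- The triangle of the Ramanujan polynomials
`r_{n+1} = (n+1) (1 + X) r_n + X² r_n'`, `r_0 = 1`. -/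
def ramanujanArray : ℕ → ℕ → ℤ
  | 0, 0 => 1
  | 0, _ + 1 => 0
  | n + 1, 0 => ((n : ℤ) + 1) * ramanujanArray n 0
  | n + 1, k + 1 =>
      ((n : ℤ) + 1) * ramanujanArray n (k + 1) + ((n : ℤ) + k + 1) * ramanujanArray n k

theorem ramanujanArray_eq_zero {n k : ℕ} (h : n < k) : ramanujanArray n k = 0 := by
  induction n generalizing k with
  | zero =>
    obtain ⟨j, rfl⟩ : ∃ j, k = j + 1 := ⟨k - 1, by omega⟩
    rfl
  | succ n ih =>
    obtain ⟨j, rfl⟩ : ∃ j, k = j + 1 := ⟨k - 1, by omega⟩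
    simp [ramanujanArray, ih (show n < j + 1 by omega), ih (show n < j by omega)]

theorem ramanujanArray_nonneg (n k : ℕ) : 0 ≤ ramanujanArray n k := by
  induction n generalizing k with
  | zero => cases k <;> simp [ramanujanArray]
  | succ n ih =>
    cases k with
    | zero => exact mul_nonneg (by positivity) (ih 0)
    | succ k =>
      exact add_nonneg (mul_nonneg (by positivity) (ih _)) (mul_nonneg (by positivity) (ih _))

theorem ramanujanArray_pos {n k : ℕ} (h : k ≤ n) : 0 < ramanujanArray n k := by
  induction n generalizing k with
  | zero => obtain rfl : k = 0 := by omega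
            simp [ramanujanArray]
  | succ n ih =>
    cases k with
    | zero => exact mul_pos (by positivity) (ih (Nat.zero_le n))
    | succ k =>
      exact add_pos_of_nonneg_of_pos (mul_nonneg (by positivity) (ramanujanArray_nonneg _ _))
        (mul_pos (by positivity) (ih (by omega)))

theorem ramanujanArray_isPosLogConcave (n : ℕ) : IsPosLogConcave (ramanujanArray n) := by
  refine ⟨ramanujanArray_nonneg n, ?_, fun k hk => ?_⟩
  swap
  · refine ramanujanArray_eq_zero ?_
    by_contra hcon
    exact (ramanujanArray_pos (show k ≤ n by omega)).ne' hk
  induction n with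
  | zero => intro k; simp [ramanujanArray]
  | succ n ih =>
    have hpos : IsPosLogConcave (ramanujanArray n) := by
      refine ⟨ramanujanArray_nonneg n, ih, fun k hk => ramanujanArray_eq_zero ?_⟩
      by_contra hcon
      exact (ramanujanArray_pos (show k ≤ n by omega)).ne' hk
    intro k
    have hn : (0 : ℤ) ≤ n := by positivity
    cases k with
    | zero =>
      simp only [ramanujanArray, zero_add]
      have h1 := hpos.logConcave 0
      have h2 := mul_nonneg (hpos.nonneg 0) (hpos.nonneg 1)
      have h3 := sq_nonneg (ramanujanArray n 0)
      simp only [zero_add] at h1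
      push_cast
      nlinarith [mul_le_mul_of_nonneg_left h1 (sq_nonneg ((n : ℤ) + 1)),
        mul_nonneg (mul_nonneg hn hn) h2, mul_nonneg hn h2, mul_nonneg (mul_nonneg hn hn) h3,
        mul_nonneg hn h3]
    | succ k =>
      simp only [ramanujanArray]
      have h1 := hpos.logConcave k
      have h2 := hpos.logConcave (k + 1)
      have h3 := hpos.mul_le_mul_inner k
      have h4 := mul_nonneg (hpos.nonneg k) (hpos.nonneg (k + 2))
      simp only [add_assoc, Nat.reduceAdd] at *
      push_cast
      have hk : (0 : ℤ) ≤ n + (k + 1) := by positivity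
      set u : ℤ := n + (k + 1) with hu
      have e1 : (n : ℤ) + (k + 1 + 1) = u + 1 := by rw [hu]; ring
      have e2 : (n : ℤ) + (k + 2 + 1) = u + 2 := by rw [hu]; ring
      rw [e1, e2]
      have hn1 : (0 : ℤ) ≤ (n : ℤ) + 1 := by positivity
      set N : ℤ := (n : ℤ) + 1
      -- Since `u(u+2) = (u+1)² - 1`, the difference of the two sides is exactly `i1 + i2 + i3 +
      -- h4`.
      have i1 := mul_nonneg (mul_nonneg hn1 hn1) (sub_nonneg.2 h2)
      have i2 := mul_nonneg (sq_nonneg (u + 1)) (sub_nonneg.2 h1)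
      have i3 := mul_nonneg (mul_nonneg hn1 hk) (sub_nonneg.2 h3)
      nlinarith

/-- The terms with factor `n+1` cancel; for `k ≥ 1` log-concavity of row `n` suffices for the rest.
-/
theorem ramanujanArray_minor_adjacent (n k : ℕ) :
    ramanujanArray n (k + 1) * ramanujanArray (n + 1) k ≤
      ramanujanArray (n + 1) (k + 1) * ramanujanArray n k := by
  have hn : (0 : ℤ) ≤ n := by positivity
  cases k with
  | zero =>
    simp only [ramanujanArray, zero_add]
    nlinarith [mul_nonneg hn (sq_nonneg (ramanujanArray n 0)), sq_nonneg (ramanujanArray n 0)]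
  | succ k =>
    have h1 := (ramanujanArray_isPosLogConcave n).logConcave k
    have hk : (0 : ℤ) ≤ (n : ℤ) + k + 1 := by positivity
    simp only [ramanujanArray, add_assoc, Nat.reduceAdd] at *
    push_cast
    nlinarith [mul_nonneg hk (sub_nonneg.2 h1), sq_nonneg (ramanujanArray n (k + 1))]

theorem ramanujanArray_minor_succ (n : ℕ) {i j : ℕ} (h : j ≤ i) :
    ramanujanArray n i * ramanujanArray (n + 1) j ≤
      ramanujanArray (n + 1) i * ramanujanArray n j := by
  induction i, h using Nat.le_induction with
  | base => rw [mul_comm]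
  | succ i _ ih =>
    rcases le_or_gt i n with hi | hi
    · have := mul_le_mul_of_ratio_trans (ramanujanArray_nonneg n j) (ramanujanArray_pos hi)
        (ramanujanArray_nonneg n (i + 1)) (c := ramanujanArray (n + 1) i)
        (e := ramanujanArray (n + 1) (i + 1)) (a := ramanujanArray (n + 1) j)
        (by linarith) (by linarith [ramanujanArray_minor_adjacent n i])
      linarith
    · rw [ramanujanArray_eq_zero (show n < i + 1 by omega), zero_mul]
      exact mul_nonneg (ramanujanArray_nonneg _ _) (ramanujanArray_nonneg _ _)

/-- The triangle is totally positive of order two. -/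
theorem ramanujanArray_minor {p n i j : ℕ} (hpn : p ≤ n) (hij : j ≤ i) :
    ramanujanArray p i * ramanujanArray n j ≤ ramanujanArray n i * ramanujanArray p j := by
  induction n, hpn using Nat.le_induction with
  | base => rfl
  | succ n hpn ih =>
    rcases le_or_gt j n with hj | hj
    · exact mul_le_mul_of_ratio_trans (ramanujanArray_nonneg p j) (ramanujanArray_pos hj)
        (ramanujanArray_nonneg (n + 1) j) ih (ramanujanArray_minor_succ n hij)
    · rw [ramanujanArray_eq_zero (show p < i by omega), zero_mul]
      exact mul_nonneg (ramanujanArray_nonneg _ _) (ramanujanArray_nonneg _ _)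

/-! ### Ramanujan polynomials and their reversals. -/

noncomputable def ramanujanPoly (n : ℕ) : ℤ[X] :=
  ∑ k ∈ Finset.range (n + 1), C (ramanujanArray n k) * X ^ k

theorem ramanujanPoly_coeff (n k : ℕ) : (ramanujanPoly n).coeff k = ramanujanArray n k := by
  simp only [ramanujanPoly, finsetSum_coeff, coeff_C_mul, coeff_X_pow]
  by_cases h : k < n + 1
  · simp [h]
  · simp [h, ramanujanArray_eq_zero (show n < k by omega)]

theorem ramanujanPoly_natDegree_le (n : ℕ) : (ramanujanPoly n).natDegree ≤ n :=
  natDegree_le_iff_coeff_eq_zero.2 fun k hk => by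
    rw [ramanujanPoly_coeff, ramanujanArray_eq_zero hk]

theorem ramanujanPoly_succ (n : ℕ) :
    ramanujanPoly (n + 1) =
      C ((n : ℤ) + 1) * ((1 + X) * ramanujanPoly n) +
        X * (X * derivative (ramanujanPoly n)) := by
  ext k
  rw [coeff_add, coeff_C_mul, add_mul 1 X, one_mul, coeff_add]
  cases k with
  | zero => simp [ramanujanPoly_coeff, ramanujanArray]
  | succ k =>
    rw [coeff_X_mul, coeff_X_mul, coeff_X_mul_derivative]
    simp only [ramanujanPoly_coeff, ramanujanArray]
    ring

/-- The Ramanujan polynomials form a strongly `q`-log-convex sequence. -/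
theorem ramanujanPoly_coeff_sub_nonneg {n p : ℕ} (h : p ≤ n) (i : ℕ) :
    0 ≤ (ramanujanPoly (n + 1) * ramanujanPoly p -
      ramanujanPoly n * ramanujanPoly (p + 1)).coeff i := by
  -- The factor `n - p` is `(n+1) - (p+1)`. One `X` is split off `X²` because the Wronskian lemma
  -- uses only one.
  have hD : ramanujanPoly (n + 1) * ramanujanPoly p - ramanujanPoly n * ramanujanPoly (p + 1) =
      C ((n : ℤ) - p) * (ramanujanPoly n * ramanujanPoly p) +
      X * (C ((n : ℤ) - p) * (ramanujanPoly n * ramanujanPoly p) +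
        X * (derivative (ramanujanPoly n) * ramanujanPoly p -
        ramanujanPoly n * derivative (ramanujanPoly p))) := by
    rw [ramanujanPoly_succ, ramanujanPoly_succ]
    simp only [map_add, map_sub]
    ring
  have hnn : ∀ k, 0 ≤ (C ((n : ℤ) - p) * (ramanujanPoly n * ramanujanPoly p)).coeff k := by
    intro k
    rw [coeff_C_mul]
    refine mul_nonneg (by omega) (coeff_mul_nonneg (fun k => ?_) (fun k => ?_) k) <;>
    · rw [ramanujanPoly_coeff]
      exact ramanujanArray_nonneg _ _
  rw [hD, coeff_add]
  refine add_nonneg (hnn i) ?_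
  cases i with
  | zero => simp
  | succ i =>
    rw [coeff_X_mul, coeff_add]
    refine add_nonneg (hnn i) (coeff_X_mul_wronskian_nonneg (fun a b hab => ?_) i)
    simp only [ramanujanPoly_coeff]
    exact ramanujanArray_minor h hab

theorem reflect_ramanujanPoly_coeff {n k : ℕ} (h : k ≤ n) :
    (reflect n (ramanujanPoly n)).coeff k = ramanujanArray n (n - k) := by
  rw [coeff_reflect, revAt_le h, ramanujanPoly_coeff]

theorem reflect_ramanujanPoly_coeff_eq_zero {n k : ℕ} (h : n < k) :
    (reflect n (ramanujanPoly n)).coeff k = 0 := by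
  rw [coeff_reflect, revAt_eq_self_of_lt h, ramanujanPoly_coeff, ramanujanArray_eq_zero h]

theorem reflect_ramanujanPoly_isPosLogConcave (n : ℕ) :
    IsPosLogConcave (reflect n (ramanujanPoly n)).coeff := by
  have hnn : ∀ k, 0 ≤ (reflect n (ramanujanPoly n)).coeff k := fun k => by
    rw [coeff_reflect, ramanujanPoly_coeff]
    exact ramanujanArray_nonneg _ _
  refine ⟨hnn, fun k => ?_, fun k hk => ?_⟩
  · rcases le_or_gt (k + 2) n with h | h
    · rw [reflect_ramanujanPoly_coeff h, reflect_ramanujanPoly_coeff (show k ≤ n by omega),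
        reflect_ramanujanPoly_coeff (show k + 1 ≤ n by omega)]
      have := (ramanujanArray_isPosLogConcave n).logConcave (n - (k + 2))
      rw [show n - (k + 2) + 2 = n - k by omega,
        show n - (k + 2) + 1 = n - (k + 1) by omega, mul_comm] at this
      exact this
    · rw [reflect_ramanujanPoly_coeff_eq_zero h, mul_zero]
      positivity
  · refine reflect_ramanujanPoly_coeff_eq_zero ?_
    by_contra hcon
    rw [reflect_ramanujanPoly_coeff (show k ≤ n by omega)] at hk
    exact (ramanujanArray_pos (Nat.sub_le n k)).ne' hk

/-- With `R = X^n r_n(1/X)`, the term `X² r_n'` turns into `n R - X R'`, whence `2n+1 = (n+1) + n`.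
-/
theorem reflect_ramanujanPoly_succ (n : ℕ) :
    reflect (n + 1) (ramanujanPoly (n + 1)) =
      C ((n : ℤ) + 1) * (X * reflect n (ramanujanPoly n)) +
        C (2 * (n : ℤ) + 1) * reflect n (ramanujanPoly n) -
        X * derivative (reflect n (ramanujanPoly n)) := by
  ext k
  rw [coeff_sub, coeff_add, coeff_C_mul, coeff_C_mul, coeff_X_mul_derivative]
  rcases lt_trichotomy k (n + 1) with h | rfl | h
  · rw [reflect_ramanujanPoly_coeff h.le, reflect_ramanujanPoly_coeff (show k ≤ n by omega)]
    obtain ⟨j, rfl⟩ : ∃ j, n = k + j := ⟨n - k, by omega⟩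
    rw [show k + j + 1 - k = j + 1 by omega, show k + j - k = j by omega]
    cases k with
    | zero =>
      simp only [ramanujanArray, coeff_X_mul_zero, zero_add,
        ramanujanArray_eq_zero (Nat.lt_succ_self j)]
      push_cast
      ring
    | succ k =>
      rw [coeff_X_mul, reflect_ramanujanPoly_coeff (show k ≤ k + 1 + j by omega),
        show k + 1 + j - k = j + 1 by omega]
      simp only [ramanujanArray]
      push_cast
      ring
  · rw [reflect_ramanujanPoly_coeff le_rfl, coeff_X_mul, reflect_ramanujanPoly_coeff le_rfl,
      reflect_ramanujanPoly_coeff_eq_zero (Nat.lt_succ_self n)]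
    simp [ramanujanArray]
  · obtain ⟨j, rfl⟩ : ∃ j, k = j + 1 := ⟨k - 1, by omega⟩
    rw [coeff_X_mul, reflect_ramanujanPoly_coeff_eq_zero h,
      reflect_ramanujanPoly_coeff_eq_zero (show n < j by omega),
      reflect_ramanujanPoly_coeff_eq_zero (show n < j + 1 by omega)]
    simp

/-! ### Transfer to the Lambert array. -/

theorem derivative_taylor_one (f : ℤ[X]) : derivative (taylor 1 f) = taylor 1 (derivative f) := by
  simp [taylor_apply, derivative_comp]

/-- The shift turns `(n+1)X + 2n+1` into `(n+1)X + 3(n+1) - 1`, so both sides obey one recurrence.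
-/
theorem lambertPoly_eq_taylor (n : ℕ) :
    lambertPoly (n + 1) = taylor 1 (reflect n (ramanujanPoly n)) := by
  induction n with
  | zero => simp [lambertPoly, lambertArray, ramanujanPoly, ramanujanArray]
  | succ n ih =>
    rw [lambertPoly_succ, ih, reflect_ramanujanPoly_succ, derivative_taylor_one]
    have htwo : taylor 1 (2 : ℤ[X]) = 2 := taylor_C 1 2
    simp only [map_sub, map_add, taylor_mul, taylor_C, taylor_X, map_mul, C_1, taylor_one, map_ofNat, htwo]
    ring

theorem lambertArray_isPosLogConcave (n : ℕ) : IsPosLogConcave (lambertArray (n + 1)) := by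
  have h := (reflect_ramanujanPoly_isPosLogConcave n).taylor_one
  rw [← lambertPoly_eq_taylor] at h
  have hc : (lambertPoly (n + 1)).coeff = lambertArray (n + 1) :=
    funext (lambertPoly_coeff (n + 1))
  rwa [hc] at h

theorem lambertArray_last_pos (n : ℕ) : 0 < lambertArray (n + 1) n := by
  induction n with
  | zero => simp [lambertArray]
  | succ n ih =>
    simp only [lambertArray, lambertArray_eq_zero (n + 1) (n + 1) le_rfl,
      lambertArray_eq_zero (n + 1) (n + 2) (by omega), mul_zero, zero_add, sub_zero]
    positivity

theorem lambertArray_pos {n k : ℕ} (h : k ≤ n) : 0 < lambertArray (n + 1) k := by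
  have hpos := lambertArray_isPosLogConcave n
  refine lt_of_le_of_ne (hpos.nonneg k) fun h0 => ?_
  exact (lambertArray_last_pos n).ne' (hpos.zero_of_le h h0.symm)

theorem lambertPoly_stronglyQLogConvex : StronglyQLogConvex fun n => lambertPoly (n + 1) := by
  intro n m hm hmn i
  obtain ⟨p, rfl⟩ : ∃ p, m = p + 1 := ⟨m - 1, by omega⟩
  simp only [Nat.add_sub_cancel, lambertPoly_eq_taylor, ← taylor_mul, ← map_sub]
  refine taylor_one_coeff_nonneg (fun k => ?_) i
  have d := ramanujanPoly_natDegree_le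
  -- Both products are reversed at the same degree `n+1+p`, so their difference is a single
  -- reversal.
  rw [← reflect_mul _ _ (d (n + 1)) (d p), ← reflect_mul _ _ (d n) (d (p + 1)),
    show n + (p + 1) = n + 1 + p by omega, ← reflect_sub, coeff_reflect]
  exact ramanujanPoly_coeff_sub_nonneg (by omega) _

theorem mainTheorem11 :
    (∀ n k : ℕ, 1 ≤ n → k < n → 0 < lambertArray n k) ∧
    (∀ n : ℕ, 1 ≤ n → IsLogConcaveSeq (lambertArray n)) ∧
    StronglyQLogConvex (fun n => lambertPoly (n + 1)) := by
  refine ⟨fun n k hn hk => ?_, fun n hn => ?_, lambertPoly_stronglyQLogConvex⟩ <;>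
    obtain ⟨m, rfl⟩ : ∃ m, n = m + 1 := ⟨n - 1, by omega⟩
  · exact lambertArray_pos (Nat.lt_succ_iff.1 hk)
  · exact (lambertArray_isPosLogConcave m).logConcave
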